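/- **Notation.** Let $n,m\in\mathbb N$ and let $\mathcal P_2(V)$ be the set of Borel probability measures on $V$ with finite second moment. For $\pi\in\mathcal P_2(\mathbb R^n\times\mathbb R^m)$ and $(X,Y)\sim\pi$, let $\pi_Y$ be the law of $Y$, $\Sigma_{XY}=\mathrm{Cov}(X,Y)\in\mathbb R^{n\times m}$, $\Sigma_{YY}=\mathrm{Cov}(Y)\in\mathbb R^{m\times m}$, let $\dagger$ denote the Moore–Penrose pseudoinverse, and put $K=\Sigma_{XY}\Sigma_{YY}^\dagger$ and $P_Y=\Sigma_{YY}\Sigma_{YY}^\dagger$ (the orthogonal projector onto the column space of $\Sigma_{YY}$). Write $\overline W=W-\mathbb E W$. The set $\mathrm E^{\mathrm{EnKU}}$ consists of all $\pi\in\mathcal P_2(\mathbb R^n\times\mathbb R^m)$ such that for $\pi_Y$-almost every $y$ the pushforward of $\pi$ under $(x,y')\mapsto x+K(y-y')$ is the conditional law $\pi_{X\mid Y=y}$. For $\pi\in \mathrm E^{\mathrm{EnKU}}$ we fix the version of the conditional law given, for every $y\in\mathbb R^m$, by $\pi_{X\mid Y=y}=\mathrm{Law}(X-KY+Ky)$.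 An affine map $\ell(x,y)=Ax+By+c$ with $A\in\mathbb R^{n\times n}$, $B\in\mathbb R^{n\times m}$, $c\in\mathbb R^n$ is *exact for $\pi$ at $y_\star$* if $\ell_\sharp\pi=\pi_{X\mid Y=y_\star}$. For $\pi\in\mathrm E^{\mathrm{EnKU}}$ there exist $\nu\in\mathcal P_2(\mathbb R^n)$ and $M\in\mathbb R^{n\times m}$ such that $(Z+MY,Y)\sim\pi$ for independent $Z\sim\nu$, $Y\sim\pi_Y$. Define subsets of $\mathrm E^{\mathrm{EnKU}}$ as follows, where in each case the condition is required for some such $(\nu,M)$: * $\pi\in\mathrm S_{\mathrm{cov}}$ iff $\mathrm{Cov}(Z)$ is singular; * $\pi\in\mathrm S_{\mathrm{dec}}$ iff there are $v\in\mathbb C^n\setminus\{0\}$, $w\in\mathbb C^m$, $\lambda,b\in\mathbb C$ with $|\lambda|<1$ such that $v^\top\overline Z$ has the same law as $\sum_{k=0}^\infty\lambda^k w^\top\overline Y^{(k)}+b$, where $\overline Y^{(k)}$ are i.i.d. copies of $\overline Y$ and the series converges almost surely; * $\pi\in\mathrm S_{\mathrm{cyc}}$ iff there are $v_1,v_2\in\mathbb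 R^n\setminus\{0\}$ and an integer $k\ge2$ such that $(v_1^\top\overline Z,v_2^\top\overline Z)^\top$ and $R_{2\pi/k}(v_1^\top\overline Z,v_2^\top\overline Z)^\top$ have the same law, where $R_\theta$ is the rotation of $\mathbb R^2$ by the angle $\theta$. **Theorem.** Let $\pi\in\mathrm E^{\mathrm{EnKU}}$, let $y_\star\in\mathbb R^m$, and let $\ell(x,y)=Ax+By+c$ be an exact affine map for $\pi$ at $y_\star$. Then: 1. If $\pi\notin\mathrm S_{\mathrm{cov}}$, then the spectral radius satisfies $\rho(A)\le1$, and $A$ is diagonalizable on the sum of the generalized eigenspaces in $\mathbb C^n$ of all eigenvalues of modulus $1$ (that space has a basis of eigenvectors of $A$). 2. If $\pi\notin\mathrm S_{\mathrm{dec}}$, then $A$ has no complex eigenvalue of modulus less than $1$, and $BP_Y=-A\,\Sigma_{XY}\Sigma_{YY}^\dagger P_Y$. 3. If $\pi\notin\mathrm S_{\mathrm{cyc}}$, then $A$ has no complex eigenvalue $\lambda$ with $|\lambda|=1$ and $\lambda\ne1$. -/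

import Mathlib

open MeasureTheory ProbabilityTheory

namespace EnKF

/-! ### Moore-Penrose pseudoinverse -/

/-- `X` is a Moore-Penrose pseudoinverse of the real matrix `A` (the four Penrose conditions). -/
structure IsPinv {m n : ℕ} (A : Matrix (Fin m) (Fin n) ℝ) (X : Matrix (Fin n) (Fin m) ℝ) :
    Prop where
  mul_mul_left : A * X * A = A
  mul_mul_right : X * A * X = X
  symm_left : (A * X).transpose = A * X
  symm_right : (X * A).transpose = X * A

theorem IsPinv.unique {m n : ℕ} {A : Matrix (Fin m) (Fin n) ℝ} {X Y : Matrix (Fin n) (Fin m) ℝ}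
    (hX : IsPinv A X) (hY : IsPinv A Y) : X = Y := by
  have h1 : A * X = A * Y := by
    calc A * X = (A * X).transpose := hX.symm_left.symm
      _ = ((A * Y) * (A * X)).transpose := by
          rw [← Matrix.mul_assoc, hY.mul_mul_left]
      _ = (A * X) * (A * Y) := by
          rw [Matrix.transpose_mul, hX.symm_left, hY.symm_left]
      _ = A * Y := by rw [← Matrix.mul_assoc, hX.mul_mul_left]
  have h2 : X * A = Y * A := by
    calc X * A = (X * A).transpose := hX.symm_right.symm
      _ = ((X * A) * (Y * A)).transpose := by
          rw [Matrix.mul_assoc, ← Matrix.mul_assoc A Y A, hY.mul_mul_left]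
      _ = (Y * A) * (X * A) := by
          rw [Matrix.transpose_mul, hX.symm_right, hY.symm_right]
      _ = Y * A := by rw [Matrix.mul_assoc, ← Matrix.mul_assoc A X A, hX.mul_mul_left]
  calc X = X * A * X := hX.mul_mul_right.symm
    _ = Y * A * Y := by rw [Matrix.mul_assoc, h1, ← Matrix.mul_assoc, h2]
    _ = Y := hY.mul_mul_right

theorem exists_isPinv_of_symm {n : ℕ} (S : Matrix (Fin n) (Fin n) ℝ) (hS : S.IsHermitian) :
    ∃ G : Matrix (Fin n) (Fin n) ℝ, IsPinv S G ∧ G.transpose = G := by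
  obtain ⟨U, V, d, hUV, hVU, hS', hVt⟩ : ∃ (U V : Matrix (Fin n) (Fin n) ℝ) (d : Fin n → ℝ),
      U * V = 1 ∧ V * U = 1 ∧ S = U * Matrix.diagonal d * V ∧ V = U.transpose := by
    refine ⟨hS.eigenvectorUnitary, star (hS.eigenvectorUnitary : Matrix (Fin n) (Fin n) ℝ),
      hS.eigenvalues, Unitary.coe_mul_star_self _, Unitary.coe_star_mul_self _, ?_, ?_⟩
    · have h := hS.spectral_theorem
      rw [Unitary.conjStarAlgAut_apply] at h
      exact h
    · rw [Matrix.star_eq_conjTranspose, Matrix.conjTranspose_eq_transpose_of_trivial]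
  have mul (e f : Fin n → ℝ) : (U * Matrix.diagonal e * V) * (U * Matrix.diagonal f * V)
      = U * Matrix.diagonal (fun i => e i * f i) * V := by
    calc (U * Matrix.diagonal e * V) * (U * Matrix.diagonal f * V)
        = U * Matrix.diagonal e * (V * U) * Matrix.diagonal f * V := by
          simp only [Matrix.mul_assoc]
      _ = U * Matrix.diagonal (fun i => e i * f i) * V := by
          rw [hVU, Matrix.mul_one, Matrix.mul_assoc U, Matrix.diagonal_mul_diagonal]
  have tr (e : Fin n → ℝ) : (U * Matrix.diagonal e * V).transpose = U * Matrix.diagonal e * V := by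
    rw [hVt, Matrix.transpose_mul, Matrix.transpose_mul, Matrix.transpose_transpose,
      Matrix.diagonal_transpose, Matrix.mul_assoc]
  refine ⟨U * Matrix.diagonal (fun i => (d i)⁻¹) * V, ⟨?_, ?_, ?_, ?_⟩, tr _⟩
  · rw [hS', mul, mul]
    simp only [mul_inv_mul_cancel]
  · rw [hS', mul, mul]
    have h : (fun i => (d i)⁻¹ * d i * (d i)⁻¹) = fun i => (d i)⁻¹ := by
      funext i
      by_cases hi : d i = 0 <;> simp [hi]
    rw [h]
  · rw [hS', mul, tr]
  · rw [hS', mul, tr]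

theorem exists_isPinv {m n : ℕ} (A : Matrix (Fin m) (Fin n) ℝ) :
    ∃ X : Matrix (Fin n) (Fin m) ℝ, IsPinv A X := by
  obtain ⟨G, hG, hGs⟩ := exists_isPinv_of_symm (A.transpose * A)
    (by rw [Matrix.IsHermitian, Matrix.conjTranspose_eq_transpose_of_trivial,
      Matrix.transpose_mul, Matrix.transpose_transpose])
  have key : A * (G * (A.transpose * A)) = A := by
    have h : A.transpose * (A * (G * (A.transpose * A)) - A) = 0 := by
      rw [Matrix.mul_sub, ← Matrix.mul_assoc, ← Matrix.mul_assoc, hG.mul_mul_left, sub_self]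
    have h' : A * (G * (A.transpose * A)) - A = A * (G * (A.transpose * A) - 1) := by
      rw [Matrix.mul_sub, Matrix.mul_one]
    have h2 : (A * (G * (A.transpose * A)) - A).transpose * (A * (G * (A.transpose * A)) - A)
        = 0 := by
      conv_lhs =>
        arg 1
        rw [h', Matrix.transpose_mul]
      rw [Matrix.mul_assoc, h, Matrix.mul_zero]
    rw [← sub_eq_zero, ← Matrix.conjTranspose_mul_self_eq_zero,
      Matrix.conjTranspose_eq_transpose_of_trivial]
    exact h2
  refine ⟨G * A.transpose, ?_, ?_, ?_, ?_⟩
  · rw [Matrix.mul_assoc, Matrix.mul_assoc, key]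
  · calc G * A.transpose * A * (G * A.transpose)
        = (G * (A.transpose * A) * G) * A.transpose := by simp only [Matrix.mul_assoc]
      _ = G * A.transpose := by rw [hG.mul_mul_right]
  · rw [Matrix.transpose_mul, Matrix.transpose_mul, Matrix.transpose_transpose, hGs,
      Matrix.mul_assoc]
  · rw [Matrix.mul_assoc, hG.symm_right]

/-- The Moore-Penrose pseudoinverse `A†`; see `isPinv_pinv` and `IsPinv.unique`. -/
noncomputable def pinv {m n : ℕ} (A : Matrix (Fin m) (Fin n) ℝ) : Matrix (Fin n) (Fin m) ℝ :=
  Classical.choose (exists_isPinv A)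

theorem isPinv_pinv {m n : ℕ} (A : Matrix (Fin m) (Fin n) ℝ) : IsPinv A (pinv A) :=
  Classical.choose_spec (exists_isPinv A)

/-! ### Laws, moments and the Kalman gain -/

/-- `ℝ^d` with the Euclidean norm and its Borel structure. -/
abbrev E (d : ℕ) : Type := EuclideanSpace ℝ (Fin d)

/-- The action of a real matrix on vectors, `M y`. -/
noncomputable abbrev act {k d : ℕ} (M : Matrix (Fin k) (Fin d) ℝ) (y : E d) : E k :=
  Matrix.toEuclideanLin M y

/-- Borel probability measures with finite second moment. -/
def P2 (V : Type*) [NormedAddCommGroup V] [MeasurableSpace V] : Set (ProbabilityMeasure V) :=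
  {μ | MemLp id 2 (μ : Measure V)}

/-- The marginal law `π_Y`. -/
noncomputable abbrev margY {n m : ℕ} (π : ProbabilityMeasure (E n × E m)) : Measure (E m) :=
  (π : Measure (E n × E m)).map Prod.snd

/-- The cross-covariance matrix `Σ_XY = Cov(X, Y)` for `(X, Y) ∼ π`. -/
noncomputable def covXY {n m : ℕ} (π : ProbabilityMeasure (E n × E m)) :
    Matrix (Fin n) (Fin m) ℝ :=
  Matrix.of fun i j => cov[fun p => p.1 i, fun p => p.2 j; (π : Measure (E n × E m))]

/-- The covariance matrix `Σ_YY = Cov(Y)` for `(X, Y) ∼ π`. -/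
noncomputable def covYY {n m : ℕ} (π : ProbabilityMeasure (E n × E m)) :
    Matrix (Fin m) (Fin m) ℝ :=
  Matrix.of fun i j => cov[fun p => p.2 i, fun p => p.2 j; (π : Measure (E n × E m))]

/-- The covariance matrix of a law on `ℝ^n`. -/
noncomputable def covMat {n : ℕ} (ν : ProbabilityMeasure (E n)) : Matrix (Fin n) (Fin n) ℝ :=
  Matrix.of fun i j => cov[fun z => z i, fun z => z j; (ν : Measure (E n))]

/-- The Kalman gain `K = Σ_XY Σ_YY†`. -/
noncomputable def gain {n m : ℕ} (π : ProbabilityMeasure (E n × E m)) :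
    Matrix (Fin n) (Fin m) ℝ :=
  covXY π * pinv (covYY π)

/-- `P_Y = Cov(Y) Cov(Y)†`, the orthogonal projector onto the column space of `Cov(Y)`. -/
noncomputable def projY {n m : ℕ} (π : ProbabilityMeasure (E n × E m)) :
    Matrix (Fin m) (Fin m) ℝ :=
  covYY π * pinv (covYY π)

/-! ### Exact affine conditioning -/

/-- The affine map `(x, y) ↦ A x + B y + c`. -/
noncomputable def affMap {n m : ℕ} (A : Matrix (Fin n) (Fin n) ℝ) (B : Matrix (Fin n) (Fin m) ℝ)
    (c : E n) (p : E n × E m) : E n :=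
  act A p.1 + act B p.2 + c

/-- With `κ` the chosen version of the Markov kernel `y ↦ π_{X|Y=y}`, the map `ℓ` is exact for
`π` at `y⋆` if `ℓ_♯ π = π_{X|Y=y⋆}`. -/
def IsExactAt {n m : ℕ} (κ : Kernel (E m) (E n)) (π : ProbabilityMeasure (E n × E m))
    (l : E n × E m → E n) (ystar : E m) : Prop :=
  (π : Measure (E n × E m)).map l = κ ystar

/-- The exact set of a conditioning map `L : (π, y⋆) ↦ L_{π,y⋆}`: the laws `π` with finite second
moment such that `L_{π,y⋆}` is exact for `π` at `π_Y`-almost every `y⋆`. This does not depend on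
the version of the conditional law of `X` given `Y`. -/
def exactSet {n m : ℕ} (L : ProbabilityMeasure (E n × E m) → E m → E n × E m → E n) :
    Set (ProbabilityMeasure (E n × E m)) :=
  {π | π ∈ P2 (E n × E m) ∧
    ∀ᵐ y ∂(margY π),
      IsExactAt (condDistrib Prod.fst Prod.snd (π : Measure (E n × E m))) π (L π y) y}

/-- The ensemble Kalman update `(x, y) ↦ x + K (y⋆ - y)`. -/
noncomputable def enku {n m : ℕ} (π : ProbabilityMeasure (E n × E m)) (ystar : E m)
    (p : E n × E m) : E n :=
  p.1 + act (gain π) (ystar - p.2)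

/-- The set of laws for which the ensemble Kalman update is exact. -/
noncomputable def EEnKU (n m : ℕ) : Set (ProbabilityMeasure (E n × E m)) := exactSet enku

/-- The law of `Z = X - K Y` for `(X, Y) ∼ π`. -/
noncomputable def residualLaw {n m : ℕ} (π : ProbabilityMeasure (E n × E m)) : Measure (E n) :=
  (π : Measure (E n × E m)).map (fun p => p.1 - act (gain π) p.2)

/-- The fixed version of the Markov kernel `y ↦ π_{X|Y=y}` for `π` in `EEnKU`: the law of
`Z + K y` with `Z = X - K Y`. -/
noncomputable def condKer {n m : ℕ} (π : ProbabilityMeasure (E n × E m)) : Kernel (E m) (E n) :=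
  (Kernel.const (E m) (π : Measure (E n × E m)) ×ₖ Kernel.id).map
    (fun q => (q.1.1 - act (gain π) q.1.2) + act (gain π) q.2)

theorem measurable_act {k d : ℕ} (M : Matrix (Fin k) (Fin d) ℝ) : Measurable (act M) :=
  (LinearMap.continuous_of_finiteDimensional (Matrix.toEuclideanLin M)).measurable

theorem condKer_apply {n m : ℕ} (π : ProbabilityMeasure (E n × E m)) (y : E m) :
    condKer π y = (residualLaw π).map (fun z => z + act (gain π) y) := by
  have h1 : Measurable (fun q : (E n × E m) × E m =>
      (q.1.1 - act (gain π) q.1.2) + act (gain π) q.2) :=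
    (measurable_fst.fst.sub ((measurable_act _).comp measurable_fst.snd)).add
      ((measurable_act _).comp measurable_snd)
  have h2 : Measurable (fun p : E n × E m => p.1 - act (gain π) p.2) :=
    measurable_fst.sub ((measurable_act _).comp measurable_snd)
  rw [condKer, residualLaw, Kernel.map_apply _ h1, Kernel.prod_apply, Kernel.const_apply,
    Kernel.id_apply, Measure.prod_dirac, Measure.map_map h1 (by fun_prop),
    Measure.map_map (by fun_prop) h2]
  rfl

/-- `condKer π` is a version of the conditional law of `X` given `Y`. -/
theorem condKer_ae_eq {n m : ℕ} {π : ProbabilityMeasure (E n × E m)} (hπ : π ∈ EEnKU n m) :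
    condKer π =ᵐ[margY π] condDistrib Prod.fst Prod.snd (π : Measure (E n × E m)) := by
  filter_upwards [hπ.2] with y hy
  have h2 : Measurable (fun p : E n × E m => p.1 - act (gain π) p.2) :=
    measurable_fst.sub ((measurable_act _).comp measurable_snd)
  rw [IsExactAt] at hy
  rw [← hy, condKer_apply, residualLaw, Measure.map_map (by fun_prop) h2]
  congr 1
  funext p
  simp only [Function.comp, enku, act, map_sub]
  abel

/-! ### The three symmetry classes -/

/-- `ν` (with finite second moment) and the linear map `M` represent `π`:
`(Z + M Y, Y) ∼ π` for independent `Z ∼ ν` and `Y ∼ π_Y`. -/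
def IsWitness {n m : ℕ} (π : ProbabilityMeasure (E n × E m)) (ν : ProbabilityMeasure (E n))
    (M : Matrix (Fin n) (Fin m) ℝ) : Prop :=
  ν ∈ P2 (E n) ∧
    ((ν : Measure (E n)).prod (margY π)).map (fun p => (p.1 + act M p.2, p.2))
      = (π : Measure (E n × E m))

/-- The complex number `vᵀ x` (no conjugation) for `v ∈ ℂ^d`, `x ∈ ℝ^d`. -/
noncomputable def cdot {d : ℕ} (v : Fin d → ℂ) (x : E d) : ℂ := ∑ i, v i * (x i : ℂ)

/-- `S_cov`: the representing law `ν` has a singular covariance matrix. -/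
def SCov (n m : ℕ) : Set (ProbabilityMeasure (E n × E m)) :=
  {π | π ∈ EEnKU n m ∧ ∃ ν M, IsWitness π ν M ∧ (covMat ν).det = 0}

/-- `S_dec`: for some `v ≠ 0`, `w`, `|λ| < 1` and `b`, the law of `vᵀ (Z - 𝔼 Z)` is the law of
`∑ₖ λᵏ wᵀ (Y⁽ᵏ⁾ - 𝔼 Y) + b`, with i.i.d. copies `Y⁽ᵏ⁾` of `Y` realized as the coordinates of the
product space `(ℝ^m)^ℕ` under the product measure, and `S` the almost sure sum of the series. -/
def SDec (n m : ℕ) : Set (ProbabilityMeasure (E n × E m)) :=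
  {π | π ∈ EEnKU n m ∧ ∃ ν M, IsWitness π ν M ∧
    ∃ (v : Fin n → ℂ) (w : Fin m → ℂ) (lam b : ℂ) (S : (ℕ → E m) → ℂ),
      v ≠ 0 ∧ ‖lam‖ < 1 ∧ Measurable S ∧
      (∀ᵐ y ∂(Measure.infinitePi fun _ : ℕ => margY π),
        HasSum (fun k => lam ^ k * cdot w (y k - ∫ x, x ∂(margY π))) (S y)) ∧
      (ν : Measure (E n)).map (fun z => cdot v (z - ∫ x, x ∂(ν : Measure (E n))))
        = (Measure.infinitePi fun _ : ℕ => margY π).map (fun y => S y + b)}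

/-- The rotation matrix `R_θ`. -/
noncomputable def rot (θ : ℝ) : Matrix (Fin 2) (Fin 2) ℝ :=
  !![Real.cos θ, -Real.sin θ; Real.sin θ, Real.cos θ]

/-- The centered projection `(v₁ᵀ (Z - 𝔼 Z), v₂ᵀ (Z - 𝔼 Z))` for `Z ∼ ν`, as a map of `Z`. -/
noncomputable def zcyc {n : ℕ} (ν : ProbabilityMeasure (E n)) (v₁ v₂ : E n) (z : E n) : E 2 :=
  !₂[inner ℝ v₁ (z - ∫ x, x ∂(ν : Measure (E n))), inner ℝ v₂ (z - ∫ x, x ∂(ν : Measure (E n)))]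

/-- `S_cyc`: for some nonzero `v₁, v₂` and some `k ≥ 2`, the law of the centered projection is
invariant under the rotation by `2π/k`. -/
def SCyc (n m : ℕ) : Set (ProbabilityMeasure (E n × E m)) :=
  {π | π ∈ EEnKU n m ∧ ∃ ν M, IsWitness π ν M ∧
    ∃ (v₁ v₂ : E n) (k : ℕ), v₁ ≠ 0 ∧ v₂ ≠ 0 ∧ 2 ≤ k ∧
      (ν : Measure (E n)).map (zcyc ν v₁ v₂)
        = (ν : Measure (E n)).map
            (fun z => act (rot (2 * Real.pi / k)) (zcyc ν v₁ v₂ z))}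

/-! ### Complex spectrum -/

/-- A real matrix viewed as a complex one. -/
noncomputable def cplx {n : ℕ} (A : Matrix (Fin n) (Fin n) ℝ) : Matrix (Fin n) (Fin n) ℂ :=
  A.map Complex.ofReal

/-- The sum of the generalized eigenspaces in `ℂ^n` of the eigenvalues of modulus one. -/
noncomputable def unitGenEigenspace {n : ℕ} (A : Matrix (Fin n) (Fin n) ℝ) :
    Submodule ℂ (Fin n → ℂ) :=
  ⨆ μ : {z : ℂ // ‖z‖ = 1}, Module.End.maxGenEigenspace (Matrix.toLin' (cplx A)) (μ : ℂ)

/-- `A` is diagonalizable on `unitGenEigenspace A`: that space has a basis of eigenvectors. -/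
def DiagonalizableOnUnit {n : ℕ} (A : Matrix (Fin n) (Fin n) ℝ) : Prop :=
  ∃ b : Module.Basis (Fin (Module.finrank ℂ (unitGenEigenspace A))) ℂ (unitGenEigenspace A),
    ∀ i, ∃ μ : ℂ, Matrix.toLin' (cplx A) (b i : Fin n → ℂ) = μ • (b i : Fin n → ℂ)

end EnKF

/-!
If the ensemble Kalman update is exact for `π`, the conditional laws of `X` given `Y` are translates
of a single law, so the residual `Z = X - K Y` is independent of `Y`
(`map_prod_residualLaw`). For such `π` the exactness of `A x + B y + c` becomes, after centering, the
stationarity equation of an autoregressive process with independent noise: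
`Z ∼ A Z + C Y` with `C = A K + B` (`IsStationary`, `isStationary_of_isExactAt`). Everything is
read off from its projections on complex vectors `v`.

* Second moments give `𝔼|vᵀZ|² = 𝔼|vᵀAZ|² + 𝔼|vᵀCY|²` (`IsStationary.secondMoment_eq`). If `Cov Z` is
  nonsingular, the left side is the square of a norm which `Aᵀ` contracts, so the powers of `A` are
  bounded; this excludes eigenvalues outside the closed unit disc, and Jordan blocks on the unit
  circle.
* For a left eigenvector `vᵀA = λvᵀ` with `|λ| < 1`, the scalar equation `vᵀZ ∼ λ vᵀZ + vᵀCY` can be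
  iterated, and `vᵀZ` has the law of `∑ λᵏ vᵀC Y⁽ᵏ⁾` (`exists_series_of_charFun`). A degenerate
  direction of `Z` is the trivial case of such a representation. If there is none, then all
  eigenvalues are unimodular and semisimple, the left eigenvectors span `ℂⁿ`, and the variance
  identity shows that each of them kills `C Y`; hence `C Σ_YY = 0`, which is the formula for `B P_Y`.
* If `|λ| = 1`, the variance identity gives `vᵀCY = 0`, so the planar law of `vᵀZ` is invariant under
  multiplication by `λ`. The angles of rotations preserving a law form a closed subgroup of `ℝ`, which
  is all of `ℝ` or cyclic, and in both cases contains some `2π/k` with `k ≥ 2` if `λ ≠ 1`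
  (`exists_rotation_invariance`).
-/

namespace EnKF

open scoped Matrix

variable {n m : ℕ}

/-! ### Complex linear forms and their second moments -/

/-- The linear form `vᵀ x` commutes with the transposed action: `vᵀ (A x) = (vᵀ A) x`. -/
theorem cdot_act {k d : ℕ} (v : Fin k → ℂ) (A : Matrix (Fin k) (Fin d) ℝ) (x : E d) :
    cdot v (act A x) = cdot (v ᵥ* A.map Complex.ofReal) x := by
  simp only [cdot, act, Matrix.vecMul, dotProduct, Matrix.map_apply, Matrix.ofLp_toLpLin,
    Matrix.toLin'_apply, Matrix.mulVec, Complex.ofReal_sum, Complex.ofReal_mul,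
    Finset.mul_sum, Finset.sum_mul]
  rw [Finset.sum_comm]
  exact Finset.sum_congr rfl fun i _ => Finset.sum_congr rfl fun j _ => by ring

theorem cdot_add {d : ℕ} (v : Fin d → ℂ) (x y : E d) : cdot v (x + y) = cdot v x + cdot v y := by
  simp [cdot, mul_add, Finset.sum_add_distrib]

theorem cdot_smul_left {d : ℕ} (c : ℂ) (v : Fin d → ℂ) (x : E d) :
    cdot (c • v) x = c * cdot v x := by
  simp [cdot, Finset.mul_sum, mul_assoc]

theorem cdot_add_left {d : ℕ} (v w : Fin d → ℂ) (x : E d) :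
    cdot (v + w) x = cdot v x + cdot w x := by
  simp [cdot, add_mul, Finset.sum_add_distrib]

@[fun_prop]
theorem continuous_cdot {d : ℕ} (v : Fin d → ℂ) : Continuous (cdot v) := by
  unfold cdot
  fun_prop

@[fun_prop]
theorem continuous_act {k d : ℕ} (M : Matrix (Fin k) (Fin d) ℝ) : Continuous (act M) :=
  LinearMap.continuous_of_finiteDimensional (Matrix.toEuclideanLin M)

/-- The real number `∫ |vᵀ x|² dμ`. For a centered law it is `v* Cov v`, up to conjugation. -/
noncomputable def secondMoment {d : ℕ} (μ : Measure (E d)) (v : Fin d → ℂ) : ℝ :=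
  ∫ x, ‖cdot v x‖ ^ 2 ∂μ

theorem memLp_cdot {d : ℕ} {μ : Measure (E d)} (hμ : MemLp id 2 μ)
    (v : Fin d → ℂ) : MemLp (cdot v) 2 μ := by
  have h (i : Fin d) : MemLp (fun x : E d => v i * (x i : ℂ)) 2 μ := by
    have h1 : MemLp (fun x : E d => (x i : ℂ)) 2 μ := by
      refine MemLp.of_le hμ (by fun_prop) (Filter.Eventually.of_forall fun x => ?_)
      simpa using PiLp.norm_apply_le x i
    exact h1.const_mul _
  exact memLp_finsetSum Finset.univ fun i _ => h i

theorem secondMoment_nonneg {d : ℕ} (μ : Measure (E d)) (v : Fin d → ℂ) :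
    0 ≤ secondMoment μ v :=
  integral_nonneg fun _ => by positivity

theorem secondMoment_eq_zero_iff {d : ℕ} {μ : Measure (E d)} [IsFiniteMeasure μ] (hμ : MemLp id 2 μ)
    (v : Fin d → ℂ) : secondMoment μ v = 0 ↔ ∀ᵐ x ∂μ, cdot v x = 0 := by
  rw [secondMoment, integral_eq_zero_iff_of_nonneg (fun _ => by positivity)
    (memLp_cdot hμ v).integrable_norm_pow']
  refine Filter.eventually_congr (Filter.Eventually.of_forall fun x => ?_)
  simp

theorem secondMoment_smul {d : ℕ} (μ : Measure (E d)) (c : ℂ) (v : Fin d → ℂ) :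
    secondMoment μ (c • v) = ‖c‖ ^ 2 * secondMoment μ v := by
  simp only [secondMoment, cdot_smul_left, norm_mul, mul_pow]
  exact integral_const_mul _ _

theorem integral_cdot {d : ℕ} {μ : Measure (E d)} [IsFiniteMeasure μ] (hμ : MemLp id 2 μ)
    (v : Fin d → ℂ) : ∫ x, cdot v x ∂μ = cdot v (∫ x, x ∂μ) := by
  let L : E d →L[ℝ] ℂ := ∑ i, v i • (Complex.ofRealCLM.comp (EuclideanSpace.proj i))
  have hL (x : E d) : L x = cdot v x := by
    simp [L, cdot]
  simp only [← hL]
  exact L.integral_comp_comm (hμ.integrable (by norm_num))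

/-! ### The residual and the stationarity equation -/

/-- A centered square-integrable probability law `ν` solves the distributional equation
`Z ∼ A Z + C Y`, with `Z ∼ ν` and `Y ∼ η` independent, and `η` centered and square-integrable. -/
structure IsStationary (ν : Measure (E n)) (η : Measure (E m)) (A : Matrix (Fin n) (Fin n) ℝ)
    (C : Matrix (Fin n) (Fin m) ℝ) : Prop where
  isProbabilityMeasure_left : IsProbabilityMeasure ν
  isProbabilityMeasure_right : IsProbabilityMeasure η
  memLp_left : MemLp id 2 ν
  memLp_right : MemLp id 2 η
  mean_left : ∫ z, z ∂ν = 0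
  mean_right : ∫ y, y ∂η = 0
  map_eq : (ν.prod η).map (fun p => act A p.1 + act C p.2) = ν

/-- The conditional law being a translate of a fixed law means exactly that the residual is
independent of `Y`. -/
theorem map_prod_residualLaw {π : ProbabilityMeasure (E n × E m)} (hπ : π ∈ EEnKU n m) :
    ((residualLaw π).prod (margY π)).map (fun p => (p.1 + act (gain π) p.2, p.2))
      = (π : Measure (E n × E m)) := by
  have hm : Measurable (fun p : E n × E m => p.1 - act (gain π) p.2) := by fun_prop
  have : IsProbabilityMeasure (residualLaw π) := Measure.isProbabilityMeasure_map hm.aemeasurable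
  have : IsProbabilityMeasure (margY π) := Measure.isProbabilityMeasure_map (by fun_prop)
  have hk : IsMarkovKernel (condKer π) := by
    refine ⟨fun y => ?_⟩
    rw [condKer_apply]
    exact Measure.isProbabilityMeasure_map (by fun_prop)
  have h1 : (margY π) ⊗ₘ condKer π = (π : Measure (E n × E m)).map (fun p => (p.2, p.1)) := by
    rw [Measure.compProd_congr (condKer_ae_eq hπ)]
    exact compProd_map_condDistrib (by fun_prop)
  have h2 : (π : Measure (E n × E m)) = ((margY π) ⊗ₘ condKer π).map Prod.swap := by
    rw [h1, Measure.map_map (by fun_prop) (by fun_prop)]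
    exact Measure.map_id.symm
  rw [h2]
  refine Measure.ext_of_lintegral _ fun f hf => ?_
  rw [lintegral_map hf (by fun_prop), lintegral_map hf (by fun_prop),
    Measure.lintegral_compProd (by fun_prop), lintegral_prod_symm _ (by fun_prop)]
  refine lintegral_congr fun y => ?_
  rw [condKer_apply, lintegral_map (by fun_prop) (by fun_prop)]
  rfl

theorem memLp_act {Ω : Type*} [MeasurableSpace Ω] {μ : Measure Ω} {k d : ℕ} {f : Ω → E d}
    (hf : MemLp f 2 μ) (M : Matrix (Fin k) (Fin d) ℝ) : MemLp (fun x => act M (f x)) 2 μ :=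
  (LinearMap.toContinuousLinearMap (Matrix.toEuclideanLin M)).comp_memLp' hf

theorem memLp_residualLaw {π : ProbabilityMeasure (E n × E m)} (hπ : π ∈ P2 (E n × E m)) :
    MemLp id 2 (residualLaw π) := by
  have h : MemLp id 2 (π : Measure (E n × E m)) := hπ
  rw [residualLaw, memLp_map_measure_iff (by fun_prop) (by fun_prop)]
  exact h.fst.sub (memLp_act h.snd _)

theorem memLp_margY {π : ProbabilityMeasure (E n × E m)} (hπ : π ∈ P2 (E n × E m)) :
    MemLp id 2 (margY π) := by
  have h : MemLp id 2 (π : Measure (E n × E m)) := hπ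
  rw [margY, memLp_map_measure_iff (by fun_prop) (by fun_prop)]
  exact h.snd

theorem integral_act {Ω : Type*} [MeasurableSpace Ω] {μ : Measure Ω} {k d : ℕ} {f : Ω → E d}
    (hf : Integrable f μ) (M : Matrix (Fin k) (Fin d) ℝ) :
    ∫ x, act M (f x) ∂μ = act M (∫ x, f x ∂μ) :=
  (LinearMap.toContinuousLinearMap (Matrix.toEuclideanLin M)).integral_comp_comm hf

/-- The law of `X - 𝔼 X` for `X ∼ μ`. -/
noncomputable def centered {d : ℕ} (μ : Measure (E d)) : Measure (E d) :=
  μ.map (fun x => x - ∫ x', x' ∂μ)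

/-- Exactness of an affine map is a distributional fixed-point equation for the centered
residual. -/
theorem isStationary_of_isExactAt {π : ProbabilityMeasure (E n × E m)} (hπ : π ∈ EEnKU n m)
    {ystar : E m} {A : Matrix (Fin n) (Fin n) ℝ} {B : Matrix (Fin n) (Fin m) ℝ} {c : E n}
    (hexact : IsExactAt (condKer π) π (affMap A B c) ystar) :
    IsStationary (centered (residualLaw π)) (centered (margY π)) A (A * gain π + B) := by
  have : IsProbabilityMeasure (residualLaw π) := Measure.isProbabilityMeasure_map (by fun_prop)
  have : IsProbabilityMeasure (margY π) := Measure.isProbabilityMeasure_map (by fun_prop)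
  have hZ := memLp_residualLaw hπ.1
  have hY := memLp_margY hπ.1
  have hZi : Integrable (fun z => z) (residualLaw π) := hZ.integrable (by norm_num)
  have hYi : Integrable (fun y => y) (margY π) := hY.integrable (by norm_num)
  have hadd (y : E m) : act (A * gain π + B) y = act A (act (gain π) y) + act B y := by
    ext i
    simp [act, Matrix.mulVec_mulVec]
  -- the exactness relation, in terms of the independent pair `(Z, Y)`
  have h1 : ((residualLaw π).prod (margY π)).map
      (fun p => act A p.1 + act (A * gain π + B) p.2 + c)
      = (residualLaw π).map (fun z => z + act (gain π) ystar) := by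
    rw [← condKer_apply, ← hexact]
    conv_rhs => rw [← map_prod_residualLaw hπ]
    rw [Measure.map_map (by unfold affMap; fun_prop) (by fun_prop)]
    congr 1
    funext p
    simp only [Function.comp, affMap, hadd, map_add]
    abel
  have h2 : act A (∫ z, z ∂residualLaw π) + act (A * gain π + B) (∫ y, y ∂margY π) + c
      = ∫ z, z ∂residualLaw π + act (gain π) ystar := by
    have h3 := congrArg (fun μ : Measure (E n) => ∫ x, x ∂μ) h1
    beta_reduce at h3
    rw [integral_map (by fun_prop) (by fun_prop), integral_map (by fun_prop) (by fun_prop),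
      integral_add hZi (integrable_const _), integral_add _ (integrable_const _),
      integral_add, integral_fun_fst (fun z => act A z),
      integral_fun_snd (fun y => act (A * gain π + B) y), integral_act hZi, integral_act hYi] at h3
    · simpa using h3
    · exact ((memLp_act hZ A).integrable (by norm_num)).comp_fst _
    · exact ((memLp_act hY _).integrable (by norm_num)).comp_snd _
    · exact (((memLp_act hZ A).integrable (by norm_num)).comp_fst _).add
        (((memLp_act hY _).integrable (by norm_num)).comp_snd _)
  refine ⟨Measure.isProbabilityMeasure_map (by fun_prop),
    Measure.isProbabilityMeasure_map (by fun_prop), ?_, ?_, ?_, ?_, ?_⟩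
  · rw [centered, memLp_map_measure_iff (by fun_prop) (by fun_prop)]
    exact hZ.sub (memLp_const _)
  · rw [centered, memLp_map_measure_iff (by fun_prop) (by fun_prop)]
    exact hY.sub (memLp_const _)
  · rw [centered, integral_map (by fun_prop) (by fun_prop), integral_sub hZi (integrable_const _)]
    simp
  · rw [centered, integral_map (by fun_prop) (by fun_prop), integral_sub hYi (integrable_const _)]
    simp
  · have h4 : centered (residualLaw π) = ((residualLaw π).map
        (fun z => z + act (gain π) ystar)).map
          (fun x => x - act (gain π) ystar - ∫ z, z ∂residualLaw π) := by
      rw [centered, Measure.map_map (by fun_prop) (by fun_prop)]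
      congr 1
      funext z
      simp
    conv_rhs => rw [h4, ← h1]
    have h5 : c = ∫ z, z ∂residualLaw π + act (gain π) ystar - (act A (∫ z, z ∂residualLaw π)
        + act (A * gain π + B) (∫ y, y ∂margY π)) := by rw [← h2]; abel
    rw [centered, centered, Measure.map_prod_map _ _ (by fun_prop) (by fun_prop),
      Measure.map_map (by fun_prop) (by fun_prop), Measure.map_map (by fun_prop) (by fun_prop)]
    congr 1
    funext p
    rw [h5]
    simp only [Function.comp, Prod.map, act, map_sub]
    abel

/-! ### The variance identity -/

variable {ν : Measure (E n)} {η : Measure (E m)} {A : Matrix (Fin n) (Fin n) ℝ}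
  {C : Matrix (Fin n) (Fin m) ℝ}

theorem IsStationary.map_cdot (h : IsStationary ν η A C) (v : Fin n → ℂ) :
    (ν.prod η).map (fun p => cdot (v ᵥ* cplx A) p.1 + cdot (v ᵥ* C.map Complex.ofReal) p.2)
      = ν.map (cdot v) := by
  have := h.isProbabilityMeasure_left
  have := h.isProbabilityMeasure_right
  conv_rhs => rw [← h.map_eq]
  rw [Measure.map_map (by fun_prop) (by fun_prop)]
  congr 1
  funext p
  simp only [Function.comp, cdot_add, cdot_act, cplx]

/-- The variance identity `Var(vᵀ Z) = Var(vᵀ A Z) + Var(vᵀ C Y)`. -/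
theorem IsStationary.secondMoment_eq (h : IsStationary ν η A C) (v : Fin n → ℂ) :
    secondMoment ν v = secondMoment ν (v ᵥ* cplx A)
      + secondMoment η (v ᵥ* C.map Complex.ofReal) := by
  have := h.isProbabilityMeasure_left
  have := h.isProbabilityMeasure_right
  have h1 : secondMoment ν v = ∫ s, ‖s‖ ^ 2 ∂(ν.map (cdot v)) := by
    rw [integral_map (by fun_prop) (by fun_prop), secondMoment]
  rw [h1, ← h.map_cdot, integral_map (by fun_prop) (by fun_prop)]
  set a := v ᵥ* cplx A
  set b := v ᵥ* C.map Complex.ofReal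
  have ha := memLp_cdot h.memLp_left a
  have hb := memLp_cdot h.memLp_right b
  have hcross : Integrable (fun p : E n × E m => star (cdot a p.1) * cdot b p.2) (ν.prod η) :=
    Integrable.mul_prod (f := fun z => star (cdot a z)) (ha.star.integrable (by norm_num))
      (hb.integrable (by norm_num))
  have hzero : ∫ p, star (cdot a p.1) * cdot b p.2 ∂(ν.prod η) = 0 := by
    rw [integral_prod_mul (fun z => star (cdot a z)) (cdot b), integral_cdot h.memLp_right,
      h.mean_right]
    simp [cdot]
  have hpt (p : E n × E m) : ‖cdot a p.1 + cdot b p.2‖ ^ 2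
      = ‖cdot a p.1‖ ^ 2 + ‖cdot b p.2‖ ^ 2 + 2 * (star (cdot a p.1) * cdot b p.2).re := by
    rw [← Complex.normSq_eq_norm_sq, ← Complex.normSq_eq_norm_sq, ← Complex.normSq_eq_norm_sq]
    simp only [Complex.normSq_apply, Complex.add_re, Complex.add_im, Complex.mul_re,
      Complex.star_def, Complex.conj_re, Complex.conj_im]
    ring
  have hia : Integrable (fun p : E n × E m => ‖cdot a p.1‖ ^ 2) (ν.prod η) :=
    Integrable.comp_fst (f := fun z => ‖cdot a z‖ ^ 2) ha.integrable_norm_pow' η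
  have hib : Integrable (fun p : E n × E m => ‖cdot b p.2‖ ^ 2) (ν.prod η) :=
    Integrable.comp_snd (f := fun y => ‖cdot b y‖ ^ 2) hb.integrable_norm_pow' ν
  simp only [hpt]
  have hic : Integrable (fun p : E n × E m => 2 * (star (cdot a p.1) * cdot b p.2).re)
      (ν.prod η) := hcross.re.const_mul 2
  rw [integral_add (by exact hia.add hib) hic, integral_add hia hib,
    integral_const_mul, integral_fun_fst (fun z => ‖cdot a z‖ ^ 2),
    integral_fun_snd (fun y => ‖cdot b y‖ ^ 2)]
  have h0 : ∫ p, (star (cdot a p.1) * cdot b p.2).re ∂(ν.prod η) = 0 := by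
    have := integral_re hcross
    rw [hzero] at this
    simpa using this
  rw [h0]
  simp [secondMoment]

/-! ### Power-bounded matrices -/

/-- The entries of all powers of `T` are bounded by a common constant. -/
def IsPowerBounded (T : Matrix (Fin n) (Fin n) ℂ) : Prop :=
  ∃ M : ℝ, ∀ (k : ℕ) (i j : Fin n), ‖(T ^ k) i j‖ ≤ M

theorem IsPowerBounded.transpose {T : Matrix (Fin n) (Fin n) ℂ} (hT : IsPowerBounded T) :
    IsPowerBounded Tᵀ := by
  obtain ⟨M, hM⟩ := hT
  refine ⟨M, fun k i j => ?_⟩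
  rw [← Matrix.transpose_pow]
  exact hM k j i

/-- A Jordan chain `T v = μ v + u`, `T u = μ u` of length two with `|μ| = 1` gives
`μ Tᵏ v = μᵏ (μ v + k u)`, which is unbounded unless `u = 0`. -/
theorem IsPowerBounded.eq_zero_of_jordan {T : Matrix (Fin n) (Fin n) ℂ} (hT : IsPowerBounded T)
    {μ : ℂ} (hμ : ‖μ‖ = 1) {u v : Fin n → ℂ} (hv : T *ᵥ v = μ • v + u) (hu : T *ᵥ u = μ • u) :
    u = 0 := by
  obtain ⟨M, hM⟩ := hT
  have hpow (k : ℕ) : μ • ((T ^ k) *ᵥ v) = μ ^ k • (μ • v + (k : ℂ) • u) := by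
    induction k with
    | zero => simp
    | succ k ih =>
      rw [pow_succ', ← Matrix.mulVec_mulVec, ← Matrix.mulVec_smul, ih, Matrix.mulVec_smul,
        Matrix.mulVec_add, Matrix.mulVec_smul, Matrix.mulVec_smul, hv, hu]
      ext i
      simp only [Pi.smul_apply, Pi.add_apply, smul_eq_mul]
      push_cast
      ring
  funext i
  by_contra hi
  have hi' : 0 < ‖u i‖ := norm_pos_iff.2 hi
  obtain ⟨k, hk⟩ := exists_nat_gt ((∑ j, M * ‖v j‖ + ‖v i‖) / ‖u i‖)
  rw [div_lt_iff₀ hi'] at hk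
  have h1 : ‖((T ^ k) *ᵥ v) i‖ = ‖μ * v i + (k : ℂ) * u i‖ := by
    have := congrArg (fun w : Fin n → ℂ => ‖w i‖) (hpow k)
    simpa [hμ] using this
  have h2 : ‖((T ^ k) *ᵥ v) i‖ ≤ ∑ j, M * ‖v j‖ := by
    refine (norm_sum_le Finset.univ fun j => (T ^ k) i j * v j).trans (Finset.sum_le_sum fun j _ => ?_)
    rw [norm_mul]
    exact mul_le_mul_of_nonneg_right (hM k i j) (norm_nonneg _)
  have h3 : (k : ℝ) * ‖u i‖ ≤ ‖μ * v i + (k : ℂ) * u i‖ + ‖v i‖ := by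
    have h4 := norm_sub_le (μ * v i + (k : ℂ) * u i) (μ * v i)
    simpa [hμ] using h4
  linarith

theorem IsPowerBounded.mulVec_eq_smul_of_mem_maxGenEigenspace {T : Matrix (Fin n) (Fin n) ℂ}
    (hT : IsPowerBounded T) {μ : ℂ} (hμ : ‖μ‖ = 1) {v : Fin n → ℂ}
    (hv : v ∈ Module.End.maxGenEigenspace (Matrix.toLin' T) μ) : T *ᵥ v = μ • v := by
  rw [Module.End.mem_maxGenEigenspace] at hv
  obtain ⟨k, hk⟩ := hv
  set f : Module.End ℂ (Fin n → ℂ) := Matrix.toLin' T - μ • 1 with hf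
  have hfv (x : Fin n → ℂ) : f x = T *ᵥ x - μ • x := by simp [hf]
  suffices h : ∀ k, (f ^ (k + 1)) v = 0 → f v = 0 by
    have h1 : f v = 0 := h k (by rw [pow_succ', Module.End.mul_apply, hk, map_zero])
    rwa [hfv, sub_eq_zero] at h1
  intro k
  induction k with
  | zero => intro h; simpa using h
  | succ k ih =>
    intro h
    refine ih ?_
    rw [pow_succ', Module.End.mul_apply] at h ⊢
    rw [pow_succ', Module.End.mul_apply] at h
    refine hT.eq_zero_of_jordan hμ (v := (f ^ k) v) ?_ ?_
    · rw [hfv]; abel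
    · rwa [hfv, sub_eq_zero] at h

theorem exists_basis_mem_of_span {V : Type*} [AddCommGroup V] [Module ℂ V]
    [FiniteDimensional ℂ V] (s : Set V) :
    ∃ b : Module.Basis (Fin (Module.finrank ℂ (Submodule.span ℂ s))) ℂ (Submodule.span ℂ s),
      ∀ i, (b i : V) ∈ s := by
  obtain ⟨f, hfs, -, hf⟩ := Submodule.exists_fun_fin_finrank_span_eq ℂ s
  let g : Fin (Module.finrank ℂ (Submodule.span ℂ s)) → Submodule.span ℂ s :=
    fun i => ⟨f i, Submodule.subset_span (hfs i)⟩
  have hg : LinearIndependent ℂ g := LinearIndependent.of_comp (Submodule.span ℂ s).subtype hf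
  refine ⟨Module.Basis.mk hg
    (hg.span_eq_top_of_card_eq_finrank' (Fintype.card_fin _)).ge, fun i => ?_⟩
  rw [Module.Basis.mk_apply]
  exact hfs i

theorem IsPowerBounded.diagonalizableOnUnit (hA : IsPowerBounded (cplx A)) :
    DiagonalizableOnUnit A := by
  have h : unitGenEigenspace A
      = Submodule.span ℂ {v | ∃ μ : ℂ, ‖μ‖ = 1 ∧ cplx A *ᵥ v = μ • v} := by
    refine le_antisymm (iSup_le fun μ v hv => Submodule.subset_span
      ⟨μ, μ.2, hA.mulVec_eq_smul_of_mem_maxGenEigenspace μ.2 hv⟩) (Submodule.span_le.2 ?_)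
    rintro v ⟨μ, hμ, hv⟩
    refine Submodule.mem_iSup_of_mem ⟨μ, hμ⟩ ?_
    rw [Module.End.mem_maxGenEigenspace]
    exact ⟨1, by simp [hv]⟩
  rw [DiagonalizableOnUnit, h]
  obtain ⟨b, hb⟩ := exists_basis_mem_of_span {v | ∃ μ : ℂ, ‖μ‖ = 1 ∧ cplx A *ᵥ v = μ • v}
  exact ⟨b, fun i => (hb i).imp fun μ hμ => by simpa using hμ.2⟩

theorem exists_left_eigenvector {T : Matrix (Fin n) (Fin n) ℂ} {z : ℂ}
    (hz : z ∈ spectrum ℂ T) : ∃ v : Fin n → ℂ, v ≠ 0 ∧ v ᵥ* T = z • v := by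
  rw [spectrum.mem_iff, Matrix.isUnit_iff_isUnit_det, isUnit_iff_ne_zero, not_not,
    ← Matrix.exists_vecMul_eq_zero_iff] at hz
  obtain ⟨v, hv, h⟩ := hz
  refine ⟨v, hv, ?_⟩
  rw [Matrix.vecMul_sub, sub_eq_zero, Algebra.algebraMap_eq_smul_one, Matrix.vecMul_smul,
    Matrix.vecMul_one] at h
  exact h.symm

theorem mem_spectrum_of_left_eigenvector {T : Matrix (Fin n) (Fin n) ℂ} {z : ℂ}
    {v : Fin n → ℂ} (hv : v ≠ 0) (h : v ᵥ* T = z • v) : z ∈ spectrum ℂ T := by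
  rw [spectrum.mem_iff, Matrix.isUnit_iff_isUnit_det, isUnit_iff_ne_zero, not_not,
    ← Matrix.exists_vecMul_eq_zero_iff]
  refine ⟨v, hv, ?_⟩
  rw [Matrix.vecMul_sub, h, Algebra.algebraMap_eq_smul_one, Matrix.vecMul_smul,
    Matrix.vecMul_one, sub_self]

/-! ### Contraction of the variance form -/

/-- `v ↦ vᵀ Z` as a linear map into `L²`. -/
noncomputable def toL2 {d : ℕ} {μ : Measure (E d)} (hμ : MemLp id 2 μ) :
    (Fin d → ℂ) →ₗ[ℂ] Lp ℂ 2 μ where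
  toFun v := (memLp_cdot hμ v).toLp
  map_add' u v := by
    rw [← MemLp.toLp_add]
    congr 1
    funext x
    exact cdot_add_left u v x
  map_smul' c v := by
    rw [RingHom.id_apply, ← MemLp.toLp_const_smul]
    congr 1
    funext x
    exact cdot_smul_left c v x

theorem norm_toL2_sq {d : ℕ} {μ : Measure (E d)} (hμ : MemLp id 2 μ) (v : Fin d → ℂ) :
    ‖toL2 hμ v‖ ^ 2 = secondMoment μ v := by
  rw [← inner_self_eq_norm_sq (𝕜 := ℂ), L2.inner_def, secondMoment, ← integral_re (by
    exact L2.integrable_inner _ _)]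
  refine integral_congr_ae ?_
  filter_upwards [(memLp_cdot hμ v).coeFn_toLp] with x hx
  simp only [toL2, LinearMap.coe_mk, AddHom.coe_mk, hx]
  exact inner_self_eq_norm_sq (𝕜 := ℂ) _

theorem IsStationary.secondMoment_vecMul_pow_le (h : IsStationary ν η A C) (v : Fin n → ℂ)
    (k : ℕ) : secondMoment ν (v ᵥ* cplx A ^ k) ≤ secondMoment ν v := by
  induction k with
  | zero => simp
  | succ k ih =>
    rw [pow_succ, ← Matrix.vecMul_vecMul]
    refine le_trans ?_ ih
    rw [h.secondMoment_eq (v ᵥ* cplx A ^ k)]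
    linarith [secondMoment_nonneg η ((v ᵥ* cplx A ^ k) ᵥ* C.map Complex.ofReal)]

/-- `Aᵀ` contracts the variance norm, and all norms on `ℂⁿ` are equivalent. -/
theorem IsStationary.isPowerBounded (h : IsStationary ν η A C)
    (hdef : ∀ v, secondMoment ν v = 0 → v = 0) : IsPowerBounded (cplx A) := by
  have hker : (toL2 h.memLp_left).ker = ⊥ := by
    rw [LinearMap.ker_eq_bot']
    intro v hv
    refine hdef v ?_
    rw [← norm_toL2_sq h.memLp_left, hv]
    simp
  obtain ⟨K, -, hK⟩ := LinearMap.exists_antilipschitzWith _ hker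
  refine ⟨∑ i, K * ‖toL2 h.memLp_left (Pi.single i 1)‖, fun k i j => ?_⟩
  have hle : ‖toL2 h.memLp_left (Pi.single i 1 ᵥ* cplx A ^ k)‖
      ≤ ‖toL2 h.memLp_left (Pi.single i 1)‖ := by
    refine (sq_le_sq₀ (norm_nonneg _) (norm_nonneg _)).1 ?_
    rw [norm_toL2_sq, norm_toL2_sq]
    exact h.secondMoment_vecMul_pow_le _ k
  calc ‖(cplx A ^ k) i j‖ = ‖(Pi.single i 1 ᵥ* cplx A ^ k) j‖ := by
        rw [Matrix.single_one_vecMul, Matrix.row]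
    _ ≤ ‖Pi.single i 1 ᵥ* cplx A ^ k‖ := norm_le_pi_norm _ j
    _ ≤ K * ‖toL2 h.memLp_left (Pi.single i 1 ᵥ* cplx A ^ k)‖ := by
        simpa using hK.le_mul_norm (map_zero _) (Pi.single i 1 ᵥ* cplx A ^ k)
    _ ≤ K * ‖toL2 h.memLp_left (Pi.single i 1)‖ := by gcongr
    _ ≤ ∑ i, K * ‖toL2 h.memLp_left (Pi.single i 1)‖ :=
        Finset.single_le_sum (f := fun i => K * ‖toL2 h.memLp_left (Pi.single i 1)‖)
          (fun i _ => by positivity) (Finset.mem_univ i)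

theorem IsStationary.norm_le_one (h : IsStationary ν η A C)
    (hdef : ∀ v, secondMoment ν v = 0 → v = 0) {z : ℂ} (hz : z ∈ spectrum ℂ (cplx A)) :
    ‖z‖ ≤ 1 := by
  obtain ⟨v, hv, hvz⟩ := exists_left_eigenvector hz
  have h1 := h.secondMoment_vecMul_pow_le v 1
  rw [pow_one, hvz, secondMoment_smul] at h1
  have h2 : 0 < secondMoment ν v :=
    (secondMoment_nonneg ν v).lt_of_ne fun h0 => hv (hdef v h0.symm)
  have h3 : ‖z‖ ^ 2 ≤ 1 := le_of_mul_le_mul_right (by rwa [one_mul]) h2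
  exact (sq_le_one_iff₀ (norm_nonneg z)).1 h3

/-- Along a left eigenvector of an eigenvalue outside the open unit disc, the noise `C Y`
vanishes. -/
theorem IsStationary.cdot_noise_ae_eq_zero (h : IsStationary ν η A C) {z : ℂ} (hz : 1 ≤ ‖z‖)
    {v : Fin n → ℂ} (hv : v ᵥ* cplx A = z • v) :
    ∀ᵐ y ∂η, cdot (v ᵥ* C.map Complex.ofReal) y = 0 := by
  have := h.isProbabilityMeasure_right
  rw [← secondMoment_eq_zero_iff h.memLp_right]
  have h1 := h.secondMoment_eq v
  rw [hv, secondMoment_smul] at h1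
  have h2 : 1 ≤ ‖z‖ ^ 2 := one_le_pow₀ hz
  nlinarith [secondMoment_nonneg ν v, secondMoment_nonneg η (v ᵥ* C.map Complex.ofReal)]

/-- If the variance form is definite and no eigenvalue lies in the open unit disc, all eigenvalues
are unimodular and semisimple, so the left eigenvectors span, and each kills the noise. -/
theorem IsStationary.forall_cdot_noise_ae_eq_zero (h : IsStationary ν η A C)
    (hdef : ∀ v, secondMoment ν v = 0 → v = 0) (hA : ∀ z ∈ spectrum ℂ (cplx A), 1 ≤ ‖z‖)
    (v : Fin n → ℂ) : ∀ᵐ y ∂η, cdot (v ᵥ* C.map Complex.ofReal) y = 0 := by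
  let W : Submodule ℂ (Fin n → ℂ) :=
    { carrier := {v | ∀ᵐ y ∂η, cdot (v ᵥ* C.map Complex.ofReal) y = 0}
      zero_mem' := by simp [cdot]
      add_mem' := fun {u v} hu hv => by
        simp only [Set.mem_ofPred_eq] at hu hv ⊢
        filter_upwards [hu, hv] with y h1 h2
        rw [Matrix.add_vecMul, cdot_add_left, h1, h2, add_zero]
      smul_mem' := fun c v hv => by
        simp only [Set.mem_ofPred_eq] at hv ⊢
        filter_upwards [hv] with y h1
        rw [Matrix.smul_vecMul, cdot_smul_left, h1, mul_zero] }
  suffices hW : W = ⊤ by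
    have : v ∈ W := by rw [hW]; trivial
    exact this
  rw [eq_top_iff, ← Module.End.iSup_maxGenEigenspace_eq_top (Matrix.toLin' (cplx A)ᵀ)]
  refine iSup_le fun z v hv => ?_
  by_cases hev : Module.End.HasEigenvalue (Matrix.toLin' (cplx A)ᵀ) z
  · obtain ⟨u, hu⟩ := hev.exists_hasEigenvector
    have hu1 : u ᵥ* cplx A = z • u := by
      have := hu.apply_eq_smul
      rwa [Matrix.toLin'_apply, Matrix.mulVec_transpose] at this
    have hzs := mem_spectrum_of_left_eigenvector hu.2 hu1
    have hz := le_antisymm (h.norm_le_one hdef hzs) (hA z hzs)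
    have h1 := (h.isPowerBounded hdef).transpose.mulVec_eq_smul_of_mem_maxGenEigenspace hz hv
    rw [Matrix.mulVec_transpose] at h1
    exact h.cdot_noise_ae_eq_zero hz.ge h1
  · have : v = 0 := by
      have hbot : Module.End.maxGenEigenspace (Matrix.toLin' (cplx A)ᵀ) z = ⊥ := by
        by_contra hne
        refine hev ?_
        exact Module.End.HasUnifEigenvalue.lt (k := ⊤) one_pos hne
      rw [hbot] at hv
      exact hv
    rw [this]
    exact W.zero_mem

/-! ### Complex projections and their characteristic functions -/

theorem charFun_map_const_mul (μ : Measure ℂ) (c t : ℂ) :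
    charFun (μ.map (c * ·)) t = charFun μ (star c * t) := by
  rw [charFun_apply, charFun_apply, integral_map (by fun_prop) (by fun_prop)]
  congr 1
  funext x
  congr 3
  simp only [Complex.inner, Complex.star_def, map_mul]
  ring_nf

theorem charFun_map_prod_mul_add {μ ρ : Measure ℂ} [IsProbabilityMeasure μ]
    [IsProbabilityMeasure ρ] (c t : ℂ) :
    charFun ((μ.prod ρ).map (fun p => c * p.1 + p.2)) t
      = charFun μ (star c * t) * charFun ρ t := by
  have : IsProbabilityMeasure (μ.map (c * ·)) := Measure.isProbabilityMeasure_map (by fun_prop)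
  rw [← charFun_map_const_mul, ← charFun_conv, Measure.conv]
  congr 1
  conv_rhs => rw [← Measure.map_id (μ := ρ)]
  rw [Measure.map_prod_map _ _ (by fun_prop) (by fun_prop),
    Measure.map_map (by fun_prop) (by fun_prop)]
  rfl

/-- For a left eigenvector `v`, the law `μ` of `vᵀ Z` solves the scalar equation
`s ∼ λ s + wᵀ Y`, `w = Cᵀ v`, which factors its characteristic function. -/
theorem IsStationary.charFun_eq (h : IsStationary ν η A C) {z : ℂ} {v : Fin n → ℂ}
    (hv : v ᵥ* cplx A = z • v) (t : ℂ) :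
    charFun (ν.map (cdot v)) t = charFun (ν.map (cdot v)) (star z * t)
      * charFun (η.map (cdot (v ᵥ* C.map Complex.ofReal))) t := by
  have := h.isProbabilityMeasure_left
  have := h.isProbabilityMeasure_right
  have : IsProbabilityMeasure (ν.map (cdot v)) := Measure.isProbabilityMeasure_map (by fun_prop)
  have : IsProbabilityMeasure (η.map (cdot (v ᵥ* C.map Complex.ofReal))) :=
    Measure.isProbabilityMeasure_map (by fun_prop)
  rw [← charFun_map_prod_mul_add, Measure.map_prod_map _ _ (by fun_prop) (by fun_prop),
    Measure.map_map (by fun_prop) (by fun_prop)]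
  conv_lhs => rw [← h.map_cdot v, hv]
  congr 2
  funext p
  simp [Function.comp, cdot_smul_left]

/-- The iterated form of the functional equation `φ t = φ (c t) ψ t`. -/
theorem eq_mul_prod_of_eq_mul {φ ψ : ℂ → ℂ} {c : ℂ} (h : ∀ t, φ t = φ (c * t) * ψ t)
    (N : ℕ) (t : ℂ) :
    φ t = φ (c ^ N * t) * ∏ k ∈ Finset.range N, ψ (c ^ k * t) := by
  induction N with
  | zero => simp
  | succ N ih =>
    rw [ih, h (c ^ N * t), Finset.prod_range_succ, pow_succ']
    ring_nf

theorem ae_summable_pow_mul {Ω : Type*} [MeasurableSpace Ω] {P : Measure Ω}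
    {X : ℕ → Ω → ℂ} (hX : ∀ k, AEStronglyMeasurable (X k) P) {a : ENNReal} (ha : a ≠ ⊤)
    (hXa : ∀ k, eLpNorm (X k) 1 P ≤ a) {c : ℂ} (hc : ‖c‖ < 1) :
    ∀ᵐ ω ∂P, Summable fun k => c ^ k * X k ω := by
  have h1 : ∑' k, eLpNorm (fun ω => c ^ k * X k ω) 1 P ≠ ⊤ := by
    refine ne_top_of_le_ne_top ?_ (ENNReal.tsum_le_tsum (g := fun k => ‖c‖ₑ ^ k * a) fun k => ?_)
    · rw [ENNReal.tsum_mul_right, ENNReal.tsum_geometric]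
      refine ENNReal.mul_ne_top (ENNReal.inv_ne_top.2 ?_) ha
      rw [ne_eq, tsub_eq_zero_iff_le, not_le, enorm_eq_nnnorm]
      exact_mod_cast hc
    · have := eLpNorm_const_smul (c ^ k) (X k) 1 P
      calc eLpNorm (fun ω => c ^ k * X k ω) 1 P = ‖c ^ k‖ₑ * eLpNorm (X k) 1 P := this
        _ ≤ ‖c‖ₑ ^ k * a := by rw [enorm_pow]; gcongr; exact hXa k
  filter_upwards [summable_norm_of_tsum_eLpNorm_ne_top le_rfl
    (fun k => (hX k).const_mul (c ^ k)) h1] with ω hω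
  exact hω.of_norm

/-- Iterating `s ∼ c s + X` with `|c| < 1` shows that the law `μ` of `s` is that of
`∑ₖ cᵏ Xₖ` with i.i.d. copies `Xₖ` of `X`. -/
theorem exists_series_of_charFun {μ : Measure ℂ} [IsProbabilityMeasure μ]
    {η : Measure (E m)} [IsProbabilityMeasure η] {g : E m → ℂ} (hg : Measurable g)
    (hg1 : eLpNorm g 1 η ≠ ⊤) {c : ℂ} (hc : ‖c‖ < 1)
    (h : ∀ t, charFun μ t = charFun μ (star c * t) * charFun (η.map g) t) :
    ∃ S : (ℕ → E m) → ℂ, Measurable S ∧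
      (∀ᵐ y ∂(Measure.infinitePi fun _ : ℕ => η), HasSum (fun k => c ^ k * g (y k)) (S y)) ∧
      μ = (Measure.infinitePi fun _ : ℕ => η).map S := by
  set P := Measure.infinitePi fun _ : ℕ => η with hP
  have heval (k : ℕ) : MeasurePreserving (fun y : ℕ → E m => y k) P η :=
    measurePreserving_eval_infinitePi _ k
  have hX (k : ℕ) : Measurable fun y : ℕ → E m => g (y k) := hg.comp (measurable_pi_apply k)
  have hSm (N : ℕ) : Measurable fun y : ℕ → E m => ∑ k ∈ Finset.range N, c ^ k * g (y k) :=
    Finset.measurable_fun_sum _ fun k _ => (hX k).const_mul _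
  have hsum : ∀ᵐ y ∂P, Summable fun k => c ^ k * g (y k) := by
    have hXn (k : ℕ) : eLpNorm (fun y : ℕ → E m => g (y k)) 1 P ≤ eLpNorm g 1 η :=
      (eLpNorm_comp_measurePreserving hg.aestronglyMeasurable (heval k)).le
    exact ae_summable_pow_mul (fun k => (hX k).aestronglyMeasurable) hg1 hXn hc
  have hlim : ∀ᵐ y ∂P, Filter.Tendsto (fun N => ∑ k ∈ Finset.range N, c ^ k * g (y k))
      Filter.atTop (nhds (∑' k, c ^ k * g (y k))) := by
    filter_upwards [hsum] with y hy using hy.hasSum.tendsto_sum_nat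
  have hmeas : AEMeasurable (fun y : ℕ → E m => ∑' k, c ^ k * g (y k)) P :=
    aemeasurable_of_tendsto_metrizable_ae Filter.atTop (fun N => (hSm N).aemeasurable) hlim
  refine ⟨hmeas.mk _, hmeas.measurable_mk, ?_, ?_⟩
  · filter_upwards [hsum, hmeas.ae_eq_mk] with y hy hy2
    rw [← hy2]
    exact hy.hasSum
  · have : IsProbabilityMeasure (P.map (hmeas.mk _)) :=
      Measure.isProbabilityMeasure_map hmeas.measurable_mk.aemeasurable
    refine Measure.ext_of_charFun (funext fun t => ?_)
    -- the characteristic functions of the partial sums are the finite products of the iteration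
    have hpart (N : ℕ) : charFun (P.map fun y => ∑ k ∈ Finset.range N, c ^ k * g (y k)) t
        = ∏ k ∈ Finset.range N, charFun (η.map g) (star c ^ k * t) := by
      have hind : iIndepFun (fun (k : ℕ) (y : ℕ → E m) => c ^ k * g (y k)) P :=
        iIndepFun_infinitePi (X := fun k x => c ^ k * g x) (fun k => by fun_prop)
      rw [(hind.restrict (Finset.range N)).charFun_map_fun_finsetSum_eq_prod
        (fun k _ => ((hX k).const_mul _).aemeasurable), Finset.prod_apply]
      refine Finset.prod_congr rfl fun k _ => ?_
      rw [← star_pow, ← charFun_map_const_mul, Measure.map_map (by fun_prop) hg,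
        ← (heval k).map_eq, Measure.map_map (by fun_prop) (by fun_prop)]
      rfl
    have hl : Filter.Tendsto
        (fun N => charFun (P.map fun y => ∑ k ∈ Finset.range N, c ^ k * g (y k)) t) Filter.atTop
        (nhds (charFun (P.map (hmeas.mk _)) t)) := by
      rw [← Measure.map_congr hmeas.ae_eq_mk, charFun_apply, integral_map hmeas (by fun_prop)]
      have heq (N : ℕ) : charFun (P.map fun y => ∑ k ∈ Finset.range N, c ^ k * g (y k)) t
          = ∫ y, Complex.exp (inner ℝ (∑ k ∈ Finset.range N, c ^ k * g (y k)) t * Complex.I) ∂P := by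
        rw [charFun_apply, integral_map (hSm N).aemeasurable (by fun_prop)]
      simp only [heq]
      refine tendsto_integral_of_dominated_convergence (fun _ => 1)
        (fun N => (Continuous.measurable (by fun_prop)
          |>.comp (hSm N) : Measurable ((fun s : ℂ => Complex.exp (inner ℝ s t * Complex.I)) ∘ _)
          ).aestronglyMeasurable)
        (integrable_const _) (fun N => Filter.Eventually.of_forall fun y => ?_) ?_
      · rw [Complex.norm_exp_ofReal_mul_I]
      · filter_upwards [hlim] with y hy
        have hcont : Continuous fun s : ℂ => Complex.exp (inner ℝ s t * Complex.I) := by fun_prop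
        exact (hcont.tendsto _).comp hy
    have hr : Filter.Tendsto (fun N => charFun μ (star c ^ N * t)) Filter.atTop (nhds 1) := by
      have h0 : Filter.Tendsto (fun N : ℕ => star c ^ N * t) Filter.atTop (nhds 0) := by
        have := (tendsto_pow_atTop_nhds_zero_of_norm_lt_one
          (x := star c) (by rwa [norm_star])).mul_const t
        simpa using this
      have h1 : charFun μ 0 = 1 := by simp
      rw [← h1]
      exact ((continuous_charFun (μ := μ)).tendsto 0).comp h0
    have hfin := hr.mul hl
    rw [one_mul] at hfin
    refine tendsto_nhds_unique (Filter.Tendsto.congr (fun N => ?_) tendsto_const_nhds) hfin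
    rw [hpart]
    exact eq_mul_prod_of_eq_mul h N t

/-! ### Rotational symmetry -/

/-- The set of angles whose rotations preserve a law on the plane is a closed subgroup of `ℝ`
containing `2π`; if it contains anything else, it contains some `2π / k` with `k ≥ 2`. -/
theorem exists_rotation_invariance {μ : Measure ℂ} [IsProbabilityMeasure μ] {z : ℂ}
    (hz : ‖z‖ = 1) (hz1 : z ≠ 1) (h : μ.map (z * ·) = μ) :
    ∃ k : ℕ, 2 ≤ k ∧ μ.map (Complex.exp ((2 * Real.pi / k : ℝ) * Complex.I) * ·) = μ := by
  have hcomp (a b : ℂ) : (μ.map (b * ·)).map (a * ·) = μ.map (a * b * ·) := by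
    rw [Measure.map_map (by fun_prop) (by fun_prop)]
    congr 1
    funext x
    simp [mul_assoc]
  let H : AddSubgroup ℝ :=
    { carrier := {θ | μ.map (Complex.exp (θ * Complex.I) * ·) = μ}
      zero_mem' := by simp
      add_mem' := fun {a b} ha hb => by
        simp only [Set.mem_ofPred_eq] at ha hb ⊢
        rw [Complex.ofReal_add, add_mul, Complex.exp_add, ← hcomp, hb, ha]
      neg_mem' := fun {a} ha => by
        simp only [Set.mem_ofPred_eq] at ha ⊢
        conv_lhs => rw [← ha]
        rw [hcomp, ← Complex.exp_add]
        simp }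
  have hmem (θ : ℝ) : θ ∈ H ↔ μ.map (Complex.exp (θ * Complex.I) * ·) = μ := Iff.rfl
  have hclosed : IsClosed (H : Set ℝ) := by
    have : (H : Set ℝ)
        = ⋂ t, {θ : ℝ | charFun μ (star (Complex.exp (θ * Complex.I)) * t) = charFun μ t} := by
      ext θ
      simp only [SetLike.mem_coe, hmem, Set.mem_iInter, Set.mem_ofPred_eq]
      constructor
      · intro hθ t
        rw [← charFun_map_const_mul, hθ]
      · intro hθ
        have : IsProbabilityMeasure (μ.map (Complex.exp (θ * Complex.I) * ·)) :=
          Measure.isProbabilityMeasure_map (by fun_prop)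
        refine Measure.ext_of_charFun (funext fun t => ?_)
        rw [charFun_map_const_mul, hθ]
    rw [this]
    refine isClosed_iInter fun t => isClosed_eq ?_ continuous_const
    exact (continuous_charFun (μ := μ)).comp (by fun_prop)
  have harg : Complex.exp (Complex.arg z * Complex.I) = z := by
    have := Complex.norm_mul_exp_arg_mul_I z
    rwa [hz, Complex.ofReal_one, one_mul] at this
  have hargH : Complex.arg z ∈ H := by rw [hmem, harg, h]
  have h2pi : 2 * Real.pi ∈ H := by
    rw [hmem]
    push_cast
    simp [Complex.exp_two_pi_mul_I]
  rcases H.dense_or_cyclic with hd | ⟨a, ha⟩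
  · refine ⟨2, le_rfl, (hmem _).1 ?_⟩
    have : (H : Set ℝ) = Set.univ := by rw [← hclosed.closure_eq, hd.closure_eq]
    rw [← SetLike.mem_coe, this]
    trivial
  · rw [ha, AddSubgroup.mem_closure_singleton] at h2pi hargH
    obtain ⟨q, hq⟩ := h2pi
    obtain ⟨p, hp⟩ := hargH
    have hq0 : q ≠ 0 := by
      rintro rfl
      simp [Real.pi_ne_zero] at hq
    have haq : 2 * Real.pi / q = a := by
      rw [← hq, zsmul_eq_mul]
      field_simp
    have hq1 : q.natAbs ≠ 1 := by
      intro h1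
      -- a generator `± 2π` would make `z = 1`
      have hexp : ∃ j : ℤ, a = j * (2 * Real.pi) := by
        rcases Int.natAbs_eq q with h2 | h2 <;> rw [h1] at h2 <;> subst h2
        · exact ⟨1, by rw [← haq]; simp⟩
        · exact ⟨-1, by rw [← haq]; simp [div_neg]⟩
      obtain ⟨j, hj⟩ := hexp
      refine hz1 ?_
      rw [← harg, ← hp, Complex.exp_eq_one_iff]
      refine ⟨p * j, ?_⟩
      rw [hj]
      simp
      ring
    refine ⟨q.natAbs, by omega, (hmem _).1 ?_⟩
    have haH : a ∈ H := by
      rw [ha]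
      exact AddSubgroup.subset_closure rfl
    rcases Int.natAbs_eq q with h2 | h2
    · have : ((q.natAbs : ℕ) : ℝ) = q := by
        rw [← Int.cast_natCast, ← h2]
      rw [this, haq]
      exact haH
    · have : ((q.natAbs : ℕ) : ℝ) = -q := by
        rw [← Int.cast_natCast, show (q.natAbs : ℤ) = -q by omega, Int.cast_neg]
      rw [this, div_neg, haq]
      exact H.neg_mem haH

/-! ### Membership in the three symmetry classes -/

/-- A degenerate direction of a law lies in the kernel of its covariance matrix. -/
theorem vecMul_covMat_eq_zero {d : ℕ} {μ : ProbabilityMeasure (E d)}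
    (hμ : MemLp id 2 (μ : Measure (E d))) {v : Fin d → ℂ}
    (hv : ∀ᵐ x ∂(centered (μ : Measure (E d))), cdot v x = 0) :
    v ᵥ* cplx (covMat μ) = 0 := by
  funext j
  have hi (i : Fin d) : MemLp (fun x : E d => x i - ∫ x, x i ∂(μ : Measure (E d))) 2
      (μ : Measure (E d)) := by
    refine MemLp.sub ?_ (memLp_const _)
    exact MemLp.of_le hμ (by fun_prop)
      (Filter.Eventually.of_forall fun x => by simpa using PiLp.norm_apply_le x i)
  have hmean (i : Fin d) : ∫ x, x i ∂(μ : Measure (E d))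
      = (∫ x, x ∂(μ : Measure (E d))) i :=
    (EuclideanSpace.proj (𝕜 := ℝ) i).integral_comp_comm (hμ.integrable (by norm_num))
  have h1 : (v ᵥ* cplx (covMat μ)) j = ∫ x, cdot v (x - ∫ x, x ∂(μ : Measure (E d)))
      * ((x j - ∫ x, x j ∂(μ : Measure (E d)) : ℝ) : ℂ) ∂(μ : Measure (E d)) := by
    simp only [Matrix.vecMul, dotProduct, cplx, covMat, Matrix.map_apply, Matrix.of_apply,
      covariance, cdot, Finset.sum_mul]
    rw [integral_finsetSum]
    · refine Finset.sum_congr rfl fun i _ => ?_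
      rw [← integral_complex_ofReal, ← integral_const_mul]
      refine integral_congr_ae (Filter.Eventually.of_forall fun x => ?_)
      simp only [PiLp.sub_apply, hmean]
      push_cast
      ring
    · intro i _
      have := ((hi i).integrable_mul (hi j)).ofReal (𝕜 := ℂ) |>.const_mul (v i)
      refine this.congr (Filter.Eventually.of_forall fun x => ?_)
      simp only [PiLp.sub_apply, Pi.mul_apply, hmean, Complex.ofReal_mul, Complex.coe_algebraMap,
        mul_assoc]
  rw [h1, Pi.zero_apply]
  have hv' := ae_of_ae_map (by fun_prop) hv
  refine integral_eq_zero_of_ae ?_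
  filter_upwards [hv'] with x hx
  rw [hx, zero_mul, Pi.zero_apply]

instance isProbabilityMeasure_residualLaw (π : ProbabilityMeasure (E n × E m)) :
    IsProbabilityMeasure (residualLaw π) :=
  Measure.isProbabilityMeasure_map (by fun_prop)

/-- The law of `Z = X - K Y`, bundled as a probability measure. -/
noncomputable def residualProb (π : ProbabilityMeasure (E n × E m)) : ProbabilityMeasure (E n) :=
  ⟨residualLaw π, inferInstance⟩

@[simp]
theorem residualProb_coe (π : ProbabilityMeasure (E n × E m)) :
    (residualProb π : Measure (E n)) = residualLaw π := rfl

instance isProbabilityMeasure_margY (π : ProbabilityMeasure (E n × E m)) :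
    IsProbabilityMeasure (margY π) :=
  Measure.isProbabilityMeasure_map (by fun_prop)

theorem isWitness_residualLaw {π : ProbabilityMeasure (E n × E m)} (hπ : π ∈ EEnKU n m) :
    IsWitness π (residualProb π) (gain π) :=
  ⟨memLp_residualLaw hπ.1, map_prod_residualLaw hπ⟩

/-- The law of `Y`, bundled as a probability measure. -/
noncomputable def margProb (π : ProbabilityMeasure (E n × E m)) : ProbabilityMeasure (E m) :=
  ⟨margY π, inferInstance⟩

@[simp]
theorem margProb_coe (π : ProbabilityMeasure (E n × E m)) :
    (margProb π : Measure (E m)) = margY π := rfl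

theorem covYY_eq_covMat (π : ProbabilityMeasure (E n × E m)) :
    covYY π = covMat (margProb π) := by
  ext i j
  simp only [covYY, covMat, Matrix.of_apply, margProb_coe]
  rw [margY, covariance_map (by fun_prop) (by fun_prop) (by fun_prop)]
  rfl

theorem map_cdot_centered {d : ℕ} (μ : Measure (E d)) (v : Fin d → ℂ) :
    (centered μ).map (cdot v) = μ.map (fun x => cdot v (x - ∫ x, x ∂μ)) := by
  rw [centered, Measure.map_map (by fun_prop) (by fun_prop)]
  rfl

variable {π : ProbabilityMeasure (E n × E m)}

theorem secondMoment_definite_of_notMem_SCov (hπ : π ∈ EEnKU n m)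
    (hst : IsStationary (centered (residualLaw π)) (centered (margY π)) A C)
    (hS : π ∉ SCov n m) (v : Fin n → ℂ) (hv : secondMoment (centered (residualLaw π)) v = 0) :
    v = 0 := by
  have := hst.isProbabilityMeasure_left
  by_contra hne
  rw [secondMoment_eq_zero_iff hst.memLp_left] at hv
  refine hS ⟨hπ, _, _, isWitness_residualLaw hπ, ?_⟩
  have h1 := vecMul_covMat_eq_zero (μ := residualProb π)
    (memLp_residualLaw hπ.1) hv
  have h2 : (cplx (covMat (residualProb π))).det = 0 :=
    Matrix.exists_vecMul_eq_zero_iff.1 ⟨v, hne, h1⟩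
  have h3 := Complex.ofRealHom.map_det (covMat (residualProb π))
  have h4 : Complex.ofRealHom (covMat (residualProb π)).det = 0 :=
    h3.trans h2
  simpa using h4

/-- A degenerate direction gives the trivial series, with `λ = 0` and `w = 0`. -/
theorem secondMoment_definite_of_notMem_SDec (hπ : π ∈ EEnKU n m)
    (hst : IsStationary (centered (residualLaw π)) (centered (margY π)) A C)
    (hS : π ∉ SDec n m) (v : Fin n → ℂ) (hv : secondMoment (centered (residualLaw π)) v = 0) :
    v = 0 := by
  have := hst.isProbabilityMeasure_left
  by_contra hne
  rw [secondMoment_eq_zero_iff hst.memLp_left] at hv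
  refine hS ⟨hπ, _, _, isWitness_residualLaw hπ, v, 0, 0, 0, fun _ => 0, hne, by simp,
    measurable_const, Filter.Eventually.of_forall fun y => ?_, ?_⟩
  · simp [cdot]
  · rw [residualProb_coe, ← map_cdot_centered, Measure.map_congr hv]
    simp only [add_zero]
    rw [Measure.map_const, Measure.map_const]
    simp

/-- An eigenvalue in the open unit disc makes a projection of the residual a geometric series of
the noise. -/
theorem one_le_norm_of_notMem_SDec (hπ : π ∈ EEnKU n m)
    (hst : IsStationary (centered (residualLaw π)) (centered (margY π)) A C)
    (hS : π ∉ SDec n m) {z : ℂ} (hz : z ∈ spectrum ℂ (cplx A)) : 1 ≤ ‖z‖ := by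
  by_contra! hlt
  obtain ⟨v, hv, hvz⟩ := exists_left_eigenvector hz
  have := hst.isProbabilityMeasure_left
  have : IsProbabilityMeasure ((centered (residualLaw π)).map (cdot v)) :=
    Measure.isProbabilityMeasure_map (by fun_prop)
  have hφ := hst.charFun_eq hvz
  rw [map_cdot_centered (margY π)] at hφ
  have hg1 : MemLp (fun y => cdot (v ᵥ* C.map Complex.ofReal) (y - ∫ x, x ∂margY π)) 2
      (margY π) := by
    have h1 := memLp_cdot hst.memLp_right (v ᵥ* C.map Complex.ofReal)
    rwa [centered, memLp_map_measure_iff (by fun_prop) (by fun_prop)] at h1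
  obtain ⟨S, hS1, hS2, hS3⟩ := exists_series_of_charFun (by fun_prop)
    (hg1.mono_exponent (by norm_num : (1 : ENNReal) ≤ 2)).2.ne hlt hφ
  refine hS ⟨hπ, _, _, isWitness_residualLaw hπ, v, v ᵥ* C.map Complex.ofReal, z, 0, S, hv, hlt,
    hS1, hS2, ?_⟩
  simp only [add_zero]
  rw [residualProb_coe, ← map_cdot_centered]
  exact hS3

theorem mul_projY_eq_zero (hπ : π ∈ EEnKU n m)
    (hC : ∀ v : Fin n → ℂ, ∀ᵐ y ∂(centered (margY π)), cdot (v ᵥ* C.map Complex.ofReal) y = 0) :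
    C * projY π = 0 := by
  have h : C * covYY π = 0 := by
    ext i k
    have h1 := congrFun (vecMul_covMat_eq_zero (μ := (margProb π))
      (memLp_margY hπ.1) (hC (Pi.single i 1))) k
    rw [← covYY_eq_covMat, Matrix.single_one_vecMul] at h1
    simp only [Matrix.vecMul, dotProduct, cplx, Matrix.row, Matrix.map_apply,
      Pi.zero_apply] at h1
    rw [Matrix.mul_apply, Matrix.zero_apply]
    exact_mod_cast h1
  rw [projY, ← Matrix.mul_assoc, h, Matrix.zero_mul]

/-- The identification of `ℂ` with the Euclidean plane. -/
noncomputable def complexToPlane (s : ℂ) : E 2 := !₂[s.re, s.im]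

theorem measurable_complexToPlane : Measurable complexToPlane := by
  have : Continuous complexToPlane := by
    refine (PiLp.continuous_toLp 2 _).comp (continuous_pi fun i => ?_)
    fin_cases i
    · exact Complex.continuous_re
    · exact Complex.continuous_im
  exact this.measurable

theorem act_rot_complexToPlane (θ : ℝ) (s : ℂ) :
    act (rot θ) (complexToPlane s) = complexToPlane (Complex.exp (θ * Complex.I) * s) := by
  ext i
  fin_cases i <;>
  · simp [act, rot, complexToPlane, Complex.exp_ofReal_mul_I_re, Complex.exp_ofReal_mul_I_im]
    ring

theorem zcyc_eq_complexToPlane (ν : ProbabilityMeasure (E n)) (v : Fin n → ℂ) (z : E n) :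
    zcyc ν (WithLp.toLp 2 fun i => (v i).re) (WithLp.toLp 2 fun i => (v i).im) z
      = complexToPlane (cdot v (z - ∫ x, x ∂(ν : Measure (E n)))) := by
  ext i
  fin_cases i <;>
  simp [zcyc, complexToPlane, cdot, PiLp.inner_apply, mul_comm]

/-- Some complex multiple of a nonzero vector has nonzero real and imaginary parts. -/
theorem exists_smul_re_ne_zero_im_ne_zero {v : Fin n → ℂ} (hv : v ≠ 0) :
    ∃ c : ℂ, (fun i => ((c • v) i).re) ≠ 0 ∧ (fun i => ((c • v) i).im) ≠ 0 := by
  by_cases hre : (fun i => (v i).re) = 0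
  · have him : (fun i => (v i).im) ≠ 0 := fun him =>
      hv (funext fun i => Complex.ext (congrFun hre i) (congrFun him i))
    refine ⟨1 + Complex.I, fun h => him ?_, fun h => him ?_⟩ <;> funext i <;>
    · have h1 := congrFun h i
      have h2 := congrFun hre i
      simp at h1 h2 ⊢
      linarith
  · by_cases him : (fun i => (v i).im) = 0
    · refine ⟨1 + Complex.I, fun h => hre ?_, fun h => hre ?_⟩ <;> funext i <;>
      · have h1 := congrFun h i
        have h2 := congrFun him i
        simp at h1 h2 ⊢
        linarith
    · exact ⟨1, by simpa using hre, by simpa using him⟩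

/-- An eigenvalue `λ ≠ 1` on the unit circle makes the planar law of `vᵀ (Z - 𝔼 Z)` invariant under
multiplication by `λ`, hence under a rotation of finite order. Rescaling `v` makes its real and
imaginary parts nonzero, also when `λ = -1` and `v` is real. -/
theorem eq_one_of_notMem_SCyc (hπ : π ∈ EEnKU n m)
    (hst : IsStationary (centered (residualLaw π)) (centered (margY π)) A C)
    (hS : π ∉ SCyc n m) {z : ℂ} (hz : z ∈ spectrum ℂ (cplx A)) (hz1 : ‖z‖ = 1) : z = 1 := by
  by_contra hne
  obtain ⟨v₀, hv₀, hvz₀⟩ := exists_left_eigenvector hz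
  obtain ⟨c, hre, him⟩ := exists_smul_re_ne_zero_im_ne_zero hv₀
  set v := c • v₀ with hv
  have hvz : v ᵥ* cplx A = z • v := by
    rw [hv, Matrix.smul_vecMul, hvz₀, smul_comm]
  have := hst.isProbabilityMeasure_left
  have := hst.isProbabilityMeasure_right
  set μ := (centered (residualLaw π)).map (cdot v) with hμ
  have : IsProbabilityMeasure μ := Measure.isProbabilityMeasure_map (by fun_prop)
  have : IsProbabilityMeasure (μ.map (z * ·)) := Measure.isProbabilityMeasure_map (by fun_prop)
  have hinv : μ.map (z * ·) = μ := by
    refine Measure.ext_of_charFun (funext fun t => ?_)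
    rw [charFun_map_const_mul, hst.charFun_eq hvz t,
      Measure.map_congr (hst.cdot_noise_ae_eq_zero hz1.ge hvz), Measure.map_const]
    simp [charFun_dirac, hμ]
  obtain ⟨k, hk, hrot⟩ := exists_rotation_invariance hz1 hne hinv
  refine hS ⟨hπ, _, _, isWitness_residualLaw hπ, WithLp.toLp 2 fun i => (v i).re,
    WithLp.toLp 2 fun i => (v i).im, k, ?_, ?_, hk, ?_⟩
  · exact fun h => hre (by simpa using h)
  · exact fun h => him (by simpa using h)
  · rw [funext (zcyc_eq_complexToPlane (residualProb π) v)]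
    simp only [act_rot_complexToPlane, residualProb_coe]
    have h1 : (residualLaw π).map (fun z => complexToPlane
        (cdot v (z - ∫ x, x ∂residualLaw π))) = μ.map complexToPlane := by
      rw [hμ, map_cdot_centered,
        Measure.map_map measurable_complexToPlane (by fun_prop)]
      rfl
    rw [h1]
    conv_lhs => rw [← hrot]
    rw [hμ, map_cdot_centered, Measure.map_map measurable_complexToPlane (by fun_prop),
      Measure.map_map (measurable_complexToPlane.comp (by fun_prop)) (by fun_prop)]
    rfl

end EnKF

theorem theorem2p3 {n m : ℕ} (π : ProbabilityMeasure (EnKF.E n × EnKF.E m))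
    (hπ : π ∈ EnKF.EEnKU n m) (ystar : EnKF.E m)
    (A : Matrix (Fin n) (Fin n) ℝ) (B : Matrix (Fin n) (Fin m) ℝ) (c : EnKF.E n)
    (hexact : EnKF.IsExactAt (EnKF.condKer π) π (EnKF.affMap A B c) ystar) :
    (π ∉ EnKF.SCov n m →
      spectralRadius ℂ (EnKF.cplx A) ≤ 1 ∧ EnKF.DiagonalizableOnUnit A) ∧
    (π ∉ EnKF.SDec n m →
      (∀ z ∈ spectrum ℂ (EnKF.cplx A), 1 ≤ ‖z‖) ∧
      B * EnKF.projY π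
        = -(A * EnKF.covXY π * EnKF.pinv (EnKF.covYY π) * EnKF.projY π)) ∧
    (π ∉ EnKF.SCyc n m →
      ∀ z ∈ spectrum ℂ (EnKF.cplx A), ‖z‖ = 1 → z = 1) := by
  have hst := EnKF.isStationary_of_isExactAt hπ hexact
  refine ⟨fun hS => ?_, fun hS => ?_, fun hS z hz hz1 =>
    EnKF.eq_one_of_notMem_SCyc hπ hst hS hz hz1⟩
  · have hdef := EnKF.secondMoment_definite_of_notMem_SCov hπ hst hS
    refine ⟨iSup₂_le fun z hz => ?_, (hst.isPowerBounded hdef).diagonalizableOnUnit⟩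
    exact_mod_cast hst.norm_le_one hdef hz
  · have hdef := EnKF.secondMoment_definite_of_notMem_SDec hπ hst hS
    have hspec : ∀ z ∈ spectrum ℂ (EnKF.cplx A), 1 ≤ ‖z‖ := fun z hz =>
      EnKF.one_le_norm_of_notMem_SDec hπ hst hS hz
    refine ⟨hspec, ?_⟩
    -- the matrix of the noise is `A K + B`
    have h := EnKF.mul_projY_eq_zero hπ (hst.forall_cdot_noise_ae_eq_zero hdef hspec)
    rw [Matrix.add_mul, add_comm, EnKF.gain, ← Matrix.mul_assoc] at h
    exact eq_neg_of_add_eq_zero_left h
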